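/- Let $G$ be a finite simple graph (not necessarily connected) embedded in the plane. Call $G$ a *near-triangulation* if every bounded face is a triangle (the outer, unbounded face may or may not be one). Call a vertex *inner* if it is not incident to the outer face, and call $G$ *internally even* if every inner vertex has even degree. Two distinct letters $x,y$ *alternate* in a word $w$ if deleting all other letters from $w$ leaves a word of the form $xyxy\cdots$ or $yxyx\cdots$ (of any length). The graph $G=(V,E)$ is *word-representable* if there is a word $w$ over the alphabet $V$, containing every letter of $V$, such that for all distinct $x,y\in V$ the letters $x$ and $y$ alternate in $w$ if and only if $xy\in E$. **Theorem.** Let $G$ be a near-triangulation that contains no $K_4$. Then $G$ is word-representable if and only if it is internally even. -/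

import Mathlib

/-!  Words and word-representable graphs. -/

section Words

variable {V : Type*} [DecidableEq V]

/-- The letters `x` and `y` alternate in the word `w`: after deleting all other letters, no two
consecutive letters are equal, that is, what remains is `xyxy⋯` or `yxyx⋯` (of any length). -/
def LettersAlternate (w : List V) (x y : V) : Prop :=
  (w.filter (fun z => z = x ∨ z = y)).IsChain (fun a b => a ≠ b)

/-- `G` is word-representable: some word over the alphabet `V`, containing every letter, is such
that distinct letters `x`, `y` alternate in it if and only if `xy` is an edge of `G`. -/
def SimpleGraph.WordRepresentable (G : SimpleGraph V) : Prop :=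
  ∃ w : List V, (∀ x : V, x ∈ w) ∧ ∀ x y : V, x ≠ y → (LettersAlternate w x y ↔ G.Adj x y)

end Words

/-!  Rotation systems: the cyclic order of the edges around every vertex. -/

/-- A rotation system on `G`. A dart `d` (an oriented edge) stands for the edge end at its tail
`d.fst`; `next` sends every dart to the next one in the cyclic order around its tail. -/
structure RotationSystem {V : Type*} (G : SimpleGraph V) where
  /-- the next dart around the tail, say counterclockwise -/
  next : Equiv.Perm G.Dart
  fst_next : ∀ d : G.Dart, (next d).fst = d.fst
  /-- all darts leaving one vertex form a single cycle -/
  sameCycle : ∀ d e : G.Dart, d.fst = e.fst → next.SameCycle d e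

namespace RotationSystem

variable {V : Type*} {G : SimpleGraph V} (R : RotationSystem G)

/-- Face tracing: go along the dart `d`, and leave its head by the dart that follows the reverse
of `d` in the cyclic order there. -/
def faceStep : Equiv.Perm G.Dart :=
  (Function.Involutive.toPerm SimpleGraph.Dart.symm SimpleGraph.Dart.symm_involutive).trans R.next

/-- The facial walks of the edges: the cycles of the face tracing permutation. -/
def FacialWalk : Type _ := Quotient (Equiv.Perm.SameCycle.setoid R.faceStep)

/-- The boundary walks of the connected components of `G`: the facial walks, and for every
isolated vertex the trivial walk that stays there. -/
abbrev BoundaryWalk : Type _ := R.FacialWalk ⊕ {v : V // ∀ u, ¬ G.Adj v u}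

/-- The facial walk through a dart. -/
def walkThrough (d : G.Dart) : R.FacialWalk :=
  Quotient.mk (Equiv.Perm.SameCycle.setoid R.faceStep) d

/-- The darts traversed by a boundary walk. -/
def walkDarts : R.BoundaryWalk → Set G.Dart
  | Sum.inl f => {d | R.walkThrough d = f}
  | Sum.inr _ => ∅

/-- The vertices on a boundary walk. -/
def walkVertices : R.BoundaryWalk → Set V
  | Sum.inl f => {v | ∃ d : G.Dart, R.walkThrough d = f ∧ d.fst = v}
  | Sum.inr v => {v.1}

/-- The boundary walks of a connected component. -/
def walksOf (C : G.ConnectedComponent) : Set R.BoundaryWalk :=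
  {b | ∃ v ∈ R.walkVertices b, G.connectedComponentMk v = C}

/-- The rotation system is planar: the surface obtained from each connected component by glueing
a disc to each of its boundary walks is a sphere, i.e. has Euler characteristic `2`. -/
def IsPlanar : Prop :=
  ∀ C : G.ConnectedComponent,
    (C.supp.ncard : ℤ) - (C.toSimpleGraph.edgeSet.ncard : ℤ) + ((R.walksOf C).ncard : ℤ) = 2

end RotationSystem

/-- A plane embedding of `G` (not necessarily connected), as combinatorial data: the cyclic orders
of the edges around the vertices, which are planar; the set of faces (the regions of the plane),
one of which is the outer (unbounded) one; and for every boundary walk the face it lies on.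
The components lie in the faces of each other in such a way that the incidence structure between
components and faces is a tree (which characterises the embeddings into the sphere). -/
structure PlaneEmbedding {V : Type*} (G : SimpleGraph V) extends RotationSystem G where
  isPlanar : toRotationSystem.IsPlanar
  /-- the faces; a finite graph has finitely many, so any universe is large enough -/
  Face : Type
  /-- the outer face -/
  outer : Face
  /-- the face that a boundary walk bounds -/
  face : toRotationSystem.BoundaryWalk → Face
  /-- the boundary walks of one component bound different faces -/
  face_injOn : ∀ C : G.ConnectedComponent, Set.InjOn face (toRotationSystem.walksOf C)
  /-- components and faces, with their incidences, form a tree -/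
  isTree : (SimpleGraph.fromRel (fun a b : G.ConnectedComponent ⊕ Face =>
    ∃ C : G.ConnectedComponent, ∃ w ∈ toRotationSystem.walksOf C,
      a = Sum.inl C ∧ b = Sum.inr (face w))).IsTree

namespace PlaneEmbedding

variable {V : Type*} {G : SimpleGraph V} (P : PlaneEmbedding G)

/-- The vertex `v` is incident to the face `F`. -/
def Incident (v : V) (F : P.Face) : Prop :=
  ∃ b, P.face b = F ∧ v ∈ P.toRotationSystem.walkVertices b

/-- The face `F` is a triangle: its boundary is a single closed walk of length three
(in a graph without loops such a walk is a 3-cycle). -/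
def IsTriangle (F : P.Face) : Prop :=
  ∃ b, (∀ b', P.face b' = F ↔ b' = b) ∧ (P.toRotationSystem.walkDarts b).ncard = 3

/-- A near-triangulation: every bounded face is a triangle. -/
def IsNearTriangulation : Prop :=
  ∀ F : P.Face, F ≠ P.outer → P.IsTriangle F

/-- Internally even: every inner vertex (one not incident to the outer face) has even degree. -/
def InternallyEven [G.LocallyFinite] : Prop :=
  ∀ v : V, ¬ P.Incident v P.outer → Even (G.degree v)

end PlaneEmbedding

/-!  Alternation of letters in terms of prefix counts. -/

section Words

variable {V : Type*} [DecidableEq V]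

/-! Suppose a word represents `G`, and fix a vertex `v`. The prefix counts of its neighbours,
suitably shifted, all lie within one of the count of `v`, and two neighbours are adjacent exactly
when their shifted counts are comparable on all prefixes (`exists_order`). So the neighbourhood is a
comparability graph. Without `K₄` the order has no chain of three, and the neighbourhood is
bipartite. Around an inner vertex the bounded faces are triangles, so cyclically consecutive
neighbours are adjacent; the two colours alternate and the degree is even.

Conversely, an internally even near-triangulation is 3-colourable, and every 3-colourable graph is
word-representable. The colouring rests on the vanishing of the first cohomology of the sphere
(`exists_potential`), used twice. Over `ZMod 2`, linear duality together with the even inner degrees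
yields a 2-colouring of the facial walks (`exists_face_bicoloring`). Over `ZMod 3`, give a dart the
value `1` or `-1` according to the colour of the triangle on its left; this is antisymmetric across
inner edges and sums to `±3 = 0` around triangles, so it is the difference of a vertex function,
which is a proper colouring because no difference is zero.

From a 3-colouring the word is a concatenation of blocks, one for each pair of vertices
(`exists_block`). In every block all edges alternate in the same pattern, and the block of a
non-adjacent pair destroys the alternation of that pair. -/

theorem LettersAlternate.symm {w : List V} {x y : V} (h : LettersAlternate w x y) :
    LettersAlternate w y x := by
  unfold LettersAlternate at *
  simpa only [or_comm] using h

/-- In every prefix of `w` the letter `x` occurs as often as `y`, or once more. -/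
def LetterLeads (w : List V) (x y : V) : Prop :=
  ∀ p : List V, p <+: w → p.count y ≤ p.count x ∧ p.count x ≤ p.count y + 1

theorem forall_prefix_cons {V : Type*} {a : V} {w : List V} {Q : List V → Prop} :
    (∀ p, p <+: a :: w → Q p) ↔ Q [] ∧ ∀ p, p <+: w → Q (a :: p) := by
  constructor
  · intro h
    exact ⟨h _ List.nil_prefix, fun p hp => h _ (by simpa using hp)⟩
  · rintro ⟨h0, h1⟩ p hp
    rcases List.prefix_cons_iff.1 hp with rfl | ⟨t, rfl, ht⟩
    · exact h0
    · exact h1 t ht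

/-- Once an initial `x` has been read, the rest of the word must be led by `y`; the induction
therefore generalises over both letters, so that they can swap roles. -/
theorem letterLeads_iff {w : List V} {x y : V} (hxy : x ≠ y) :
    LetterLeads w x y ↔
      LettersAlternate w x y ∧ (w.filter (fun z => z = x ∨ z = y)).head? ≠ some y := by
  induction w generalizing x y with
  | nil => simp [LetterLeads, LettersAlternate]
  | cons a w ih =>
    have hfilt : (fun z => decide (z = y ∨ z = x)) = fun z => decide (z = x ∨ z = y) := by
      funext z; simp only [or_comm]
    unfold LetterLeads
    rw [forall_prefix_cons]
    by_cases hax : a = x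
    · subst hax
      have h := ih hxy.symm
      unfold LetterLeads LettersAlternate at h
      rw [hfilt] at h
      have e : (∀ p, p <+: w → List.count y (a :: p) ≤ List.count a (a :: p) ∧
          List.count a (a :: p) ≤ List.count y (a :: p) + 1) ↔
          ∀ p, p <+: w → List.count a p ≤ List.count y p ∧
            List.count y p ≤ List.count a p + 1 := by
        refine forall_congr' fun p => imp_congr_right fun _ => ?_
        rw [List.count_cons_self, List.count_cons_of_ne hxy]
        omega
      rw [e, h]
      simp only [LettersAlternate, List.filter_cons]
      simp only [List.isChain_cons, List.count_nil, true_or, decide_true, if_true, List.head?_cons, ne_eq,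
        Option.some.injEq, hxy, not_false_eq_true, and_true, le_refl, zero_add, zero_le, true_and,
        Option.mem_def]
      constructor
      · rintro ⟨h1, h2⟩
        exact ⟨fun y hy e => h2 (e ▸ hy), h1⟩
      · rintro ⟨h1, h2⟩
        exact ⟨h2, fun e => h1 a e rfl⟩
    · by_cases hay : a = y
      · subst hay
        constructor
        · rintro ⟨-, h⟩
          have := (h [] List.nil_prefix).1
          simp [hxy.symm] at this
        · rintro ⟨-, h⟩
          simp at h
      · have h := ih hxy
        unfold LetterLeads LettersAlternate at h
        have e : (∀ p, p <+: w → List.count y (a :: p) ≤ List.count x (a :: p) ∧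
          List.count x (a :: p) ≤ List.count y (a :: p) + 1) ↔
          ∀ p, p <+: w → List.count y p ≤ List.count x p ∧
            List.count x p ≤ List.count y p + 1 := by
          refine forall_congr' fun p => imp_congr_right fun _ => ?_
          rw [List.count_cons_of_ne hax, List.count_cons_of_ne hay]
        rw [e, h]
        simp [LettersAlternate, hax, hay]

theorem lettersAlternate_iff {w : List V} {x y : V} (hxy : x ≠ y) :
    LettersAlternate w x y ↔ LetterLeads w x y ∨ LetterLeads w y x := by
  constructor
  · intro h
    by_cases hy : (w.filter (fun z => z = x ∨ z = y)).head? = some y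
    · right
      refine (letterLeads_iff hxy.symm).2 ⟨h.symm, ?_⟩
      simp only [or_comm]
      rw [hy]
      simpa using hxy.symm
    · exact Or.inl ((letterLeads_iff hxy).2 ⟨h, hy⟩)
  · rintro (h | h)
    · exact ((letterLeads_iff hxy).1 h).1
    · exact ((letterLeads_iff hxy.symm).1 h).1.symm

/-!  The neighbourhood of a vertex in a word-representable graph without `K₄`. -/

theorem count_sub_count_not_constant {w : List V} {x : V} (hx : x ∈ w) {y : V} (hxy : x ≠ y) (k : ℤ)
    (h : ∀ p, p <+: w → (p.count x : ℤ) - p.count y = k) : False := by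
  obtain ⟨s, t, rfl⟩ := List.append_of_mem hx
  have h1 := h s (List.prefix_append _ _)
  have h2 := h (s ++ [x]) ⟨t, by simp⟩
  rw [List.count_append, List.count_append, List.count_singleton_self,
    List.count_singleton, if_neg (by simpa using hxy)] at h2
  push_cast at h2
  omega

/-- Subtracting one from the counts of the letters that lead `v` puts all neighbours of `v` at the
height of `v` or one below it. Alternation of two neighbours then becomes pointwise comparability,
which is transitive. It is antisymmetric because the difference of two letter counts cannot be
constant when one of the letters occurs. -/
theorem SimpleGraph.WordRepresentable.exists_order {G : SimpleGraph V}
    (hG : G.WordRepresentable) (v : V) :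
    ∃ r : V → V → Prop, (∀ x y z, r x y → r y z → r x z) ∧
      (∀ x y, G.Adj v x → G.Adj v y → x ≠ y → (r x y ∨ r y x ↔ G.Adj x y)) ∧
      (∀ x y, x ≠ y → r x y → ¬ r y x) := by
  classical
  obtain ⟨w, hw, hadj⟩ := hG
  let s : V → ℤ := fun x => if LetterLeads w x v then 1 else 0
  let f : V → List V → ℤ := fun x p => p.count x - s x
  have hs : ∀ x, G.Adj v x → ∀ p, p <+: w → f x p ≤ p.count v ∧ (p.count v : ℤ) ≤ f x p + 1 := by
    intro x hx p hp
    have := (lettersAlternate_iff hx.ne).1 ((hadj v x hx.ne).2 hx)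
    by_cases h : LetterLeads w x v
    · have h1 := h p hp
      simp only [f, s, if_pos h]
      omega
    · have h1 := (this.resolve_right h) p hp
      simp only [f, s, if_neg h]
      omega
  refine ⟨fun x y => ∀ p, p <+: w → f y p ≤ f x p, ?_, ?_, ?_⟩
  · intro x y z h1 h2 p hp
    exact (h2 p hp).trans (h1 p hp)
  · intro x y hx hy hxy
    rw [← hadj x y hxy, lettersAlternate_iff hxy]
    have hsx := hs x hx
    have hsy := hs y hy
    have hnx : s x = 0 → LetterLeads w v x := by
      intro h0
      have h1 := (lettersAlternate_iff hx.ne).1 ((hadj v x hx.ne).2 hx)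
      refine h1.resolve_right fun h => ?_
      simp only [s, if_pos h] at h0
      omega
    have hny : s y = 0 → LetterLeads w v y := by
      intro h0
      have h1 := (lettersAlternate_iff hy.ne).1 ((hadj v y hy.ne).2 hy)
      refine h1.resolve_right fun h => ?_
      simp only [s, if_pos h] at h0
      omega
    have hpx : s x ≠ 0 → LetterLeads w x v := by
      intro h0
      by_contra h
      simp only [s, if_neg h] at h0
      omega
    have hpy : s y ≠ 0 → LetterLeads w y v := by
      intro h0
      by_contra h
      simp only [s, if_neg h] at h0
      omega
    have s01 : ∀ x, s x = 0 ∨ s x = 1 := by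
      intro x
      simp only [s]
      split_ifs <;> simp
    have hnil := List.nil_prefix (l := w)
    simp only [f] at hsx hsy ⊢
    unfold LetterLeads at *
    rcases s01 x with hx0 | hx0 <;> rcases s01 y with hy0 | hy0 <;>
      rw [hx0] at hsx ⊢ <;> rw [hy0] at hsy ⊢
    · constructor
      · rintro (h | h)
        · exact Or.inl fun p hp => by have := h p hp; have := hsx p hp; have := hsy p hp; omega
        · exact Or.inr fun p hp => by have := h p hp; have := hsx p hp; have := hsy p hp; omega
      · rintro (h | h)
        · exact Or.inl fun p hp => by have := h p hp; omega
        · exact Or.inr fun p hp => by have := h p hp; omega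
    -- The shifts differ: `y` leads `v` and `v` leads `x`. The empty prefix excludes one direction
    -- of the order; the half of the alternation that the other direction does not give follows from
    -- the count of `v` lying in between.
    · have a := hnx hx0
      have b := hpy (by omega)
      constructor
      · rintro (h | h)
        · exact Or.inr fun p hp => by have := h p hp; have := a p hp; have := b p hp; omega
        · have := h [] hnil
          simp at this
      · rintro (h | h)
        · exact Or.inl fun p hp => by
            have := h p hp; have := a p hp; have := b p hp; omega
        · exact Or.inl fun p hp => by have := h p hp; omega
    · have a := hny hy0
      have b := hpx (by omega)
      constructor
      · rintro (h | h)
        · have := h [] hnil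
          simp at this
        · exact Or.inl fun p hp => by have := h p hp; have := a p hp; have := b p hp; omega
      · rintro (h | h)
        · exact Or.inr fun p hp => by have := h p hp; omega
        · exact Or.inr fun p hp => by have := h p hp; have := a p hp; have := b p hp; omega
    · constructor
      · rintro (h | h)
        · exact Or.inl fun p hp => by have := h p hp; have := hsx p hp; have := hsy p hp; omega
        · exact Or.inr fun p hp => by have := h p hp; have := hsx p hp; have := hsy p hp; omega
      · rintro (h | h)
        · exact Or.inl fun p hp => by have := h p hp; omega
        · exact Or.inr fun p hp => by have := h p hp; omega
  · intro x y hxy h1 h2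
    refine count_sub_count_not_constant (hw x) hxy (s x - s y) fun p hp => ?_
    have := h1 p hp
    have := h2 p hp
    simp only [f] at *
    omega

/-- In a word-representable graph without `K₄` all neighbourhoods are bipartite. -/
theorem SimpleGraph.WordRepresentable.exists_neighbor_bicoloring {G : SimpleGraph V}
    (hG : G.WordRepresentable) (hK4 : G.CliqueFree 4) (v : V) :
    ∃ q : V → Prop, ∀ x y, G.Adj v x → G.Adj v y → G.Adj x y → (q x ↔ ¬ q y) := by
  obtain ⟨r, htrans, hr, hanti⟩ := hG.exists_order v
  -- In a chain of three neighbours, transitivity makes the extreme ones adjacent, which completes a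
  -- `K₄` with `v`.
  have key : ∀ x y, G.Adj v x → G.Adj v y → G.Adj x y → r x y →
      ∀ z, G.Adj v z → G.Adj y z → ¬ r y z := by
    intro x y hx hy hxy h1 z hz hyz h2
    have hxz : x ≠ z := by
      rintro rfl
      exact hanti x y hxy.ne h1 h2
    have hxz' : G.Adj x z := (hr x z hx hz hxz).1 (Or.inl (htrans x y z h1 h2))
    refine hK4 _ ((SimpleGraph.is3Clique_triple_iff.2 ⟨hxy, hxz', hyz⟩).insert (a := v) ?_)
    simp [hx, hy, hz]
  -- Without chains of three, the upper end of an edge has something below it and the lower end has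
  -- nothing.
  refine ⟨fun x => ∃ y, G.Adj v y ∧ G.Adj x y ∧ r x y, fun x y hx hy hxy => ?_⟩
  rcases (hr x y hx hy hxy.ne).2 hxy with h | h
  · refine iff_of_true ⟨y, hy, hxy, h⟩ ?_
    rintro ⟨z, hz, hyz, h'⟩
    exact key x y hx hy hxy h z hz hyz h'
  · refine iff_of_false ?_ (not_not.2 ⟨x, hx, hxy.symm, h⟩)
    rintro ⟨z, hz, hxz, h'⟩
    exact key y x hy hx hxy.symm h z hz hxz h'

/-!  Graphs with a 3-colouring are word-representable. -/

theorem filter_finset_toList (S : Finset V) {a b : V} (hab : ¬ (a ∈ S ∧ b ∈ S)) :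
    S.toList.filter (fun z => z = a ∨ z = b) =
      if a ∈ S then [a] else if b ∈ S then [b] else [] := by
  have key : ∀ c d : V, d ∉ S → S.toList.filter (fun z => z = c ∨ z = d) =
      if c ∈ S then [c] else [] := by
    intro c d hd
    have : S.toList.filter (fun z => z = c ∨ z = d) = S.toList.filter (fun z => z = c) := by
      refine List.filter_congr fun z hz => ?_
      have : z ≠ d := by
        rintro rfl
        exact hd (by simpa using hz)
      simp [this]
    rw [this, List.filter_eq]
    split_ifs with hc
    · rw [List.count_eq_one_of_mem S.nodup_toList (by simpa using hc)]
      rfl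
    · rw [List.count_eq_zero_of_not_mem (by simpa using hc)]
      rfl
  by_cases hb : b ∈ S
  · have ha : a ∉ S := fun h => hab ⟨h, hb⟩
    have := key b a ha
    simp only [or_comm] at this ⊢
    rw [this]
    simp [ha]
  · rw [key a b hb]
    simp [hb]

/-- A block of a word, reading the sets of a list one after the other. -/
noncomputable def blockWord (T : List (Finset V)) : List V := T.flatMap Finset.toList

theorem filter_blockWord (T : List (Finset V)) {a b : V} (h : ∀ S ∈ T, ¬ (a ∈ S ∧ b ∈ S)) :
    (blockWord T).filter (fun z => z = a ∨ z = b) =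
      T.flatMap fun S => if a ∈ S then [a] else if b ∈ S then [b] else [] := by
  unfold blockWord
  rw [List.filter_flatMap]
  refine List.flatMap_congr fun S hS => ?_
  exact filter_finset_toList S (h S hS)

/-- Each set is read in an arbitrary order, so it must not contain both letters of a pair whose
restriction is to be known. That restriction is then computed set by set, and a repeated letter in
it rules out alternation. -/
theorem exists_block_of_sets {G : SimpleGraph V} (c : G.Coloring (Fin 3)) (x y : V)
    (T : List (Finset V)) (hcover : ∀ a, ∃ s ∈ T, a ∈ s)
    (hmono : ∀ s ∈ T, ∀ a ∈ s, ∀ b ∈ s, c a = c b)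
    (hsep : ∀ s ∈ T, ∀ a ∈ s, ∀ b ∈ s, a = x → b = y → a = b)
    (hadj : ∀ a b, G.Adj a b → c a < c b →
      (T.flatMap fun s => if a ∈ s then [a] else if b ∈ s then [b] else []) = [a, b, a, b])
    (hnadj : x ≠ y → ¬ G.Adj x y → ∃ l₁ z l₂,
      (T.flatMap fun s => if x ∈ s then [x] else if y ∈ s then [y] else []) =
        l₁ ++ [z, z] ++ l₂) :
    ∃ u : List V, (∀ a, a ∈ u) ∧
      (∀ a b, G.Adj a b → c a < c b → u.filter (fun z => z = a ∨ z = b) = [a, b, a, b]) ∧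
      (x ≠ y → ¬ G.Adj x y → ¬ LettersAlternate u x y) := by
  refine ⟨blockWord T, fun a => ?_, fun a b hab hc => ?_, fun hne hxy halt => ?_⟩
  · simpa [blockWord] using hcover a
  · rw [filter_blockWord T, hadj a b hab hc]
    rintro s hs ⟨ha, hb⟩
    exact hc.ne (hmono s hs a ha b hb)
  · obtain ⟨l₁, z, l₂, h⟩ := hnadj hne hxy
    unfold LettersAlternate at halt
    rw [filter_blockWord T, h] at halt
    · have := halt.infix (l₁ := [z, z]) ⟨l₁, l₂, rfl⟩
      simp at this
    · rintro s hs ⟨hx, hy⟩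
      exact hne (hsep s hs x hx y hy rfl rfl)

/-- The pattern `abab` starts with the lower colour and ends with the higher one, so concatenating
blocks never spoils an edge, while one bad block suffices to spoil a non-edge. The blocks are two
rounds through the colour classes, slightly perturbed at `x` and `y`. -/
theorem exists_block [Fintype V] {G : SimpleGraph V} (c : G.Coloring (Fin 3)) (x y : V)
    (hxy : c x ≤ c y) :
    ∃ u : List V, (∀ a, a ∈ u) ∧
      (∀ a b, G.Adj a b → c a < c b → u.filter (fun z => z = a ∨ z = b) = [a, b, a, b]) ∧
      (x ≠ y → ¬ G.Adj x y → ¬ LettersAlternate u x y) := by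
  let S : Fin 3 → Finset V := fun i => Finset.univ.filter fun v => c v = i
  have hS : ∀ i v, v ∈ S i ↔ c v = i := fun i v => by simp [S]
  clear_value S
  have h3 : ∀ i : Fin 3, i = 0 ∨ i = 1 ∨ i = 2 := by decide
  have hlt : ∀ i j : Fin 3, i < j → (i = 0 ∧ j = 1) ∨ (i = 1 ∧ j = 2) ∨ (i = 0 ∧ j = 2) := by
    decide
  by_cases hcxy : c x = c y ∨ G.Adj x y
  -- The order inside a class does not affect edges. Within its class `x` comes first in the first
  -- round and last in the second, so a `y` of the same colour gives `xyyx`.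
  · refine exists_block_of_sets c x y [S 0 ∩ {x}, S 0 \ {x}, S 1 ∩ {x}, S 1 \ {x}, S 2 ∩ {x},
      S 2 \ {x}, S 0 \ {x}, S 0 ∩ {x}, S 1 \ {x}, S 1 ∩ {x}, S 2 \ {x}, S 2 ∩ {x}] ?_ ?_ ?_ ?_ ?_
    · intro a
      rcases h3 (c a) with ha | ha | ha <;> rcases eq_or_ne a x with rfl | hax <;>
        simp [*]
    · intro s hs
      simp only [List.mem_cons, List.not_mem_nil, or_false] at hs
      rcases hs with rfl | rfl | rfl | rfl | rfl | rfl | rfl | rfl | rfl | rfl | rfl | rfl <;>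
        simp only [Finset.mem_inter, Finset.mem_sdiff, Finset.mem_singleton, hS] <;> grind
    · intro s hs
      simp only [List.mem_cons, List.not_mem_nil, or_false] at hs
      rcases hs with rfl | rfl | rfl | rfl | rfl | rfl | rfl | rfl | rfl | rfl | rfl | rfl <;>
        simp only [Finset.mem_inter, Finset.mem_sdiff, Finset.mem_singleton, hS] <;> grind
    · intro a b hab hc
      have hne := hab.ne
      have hne' := hab.ne.symm
      obtain ⟨ha, hb⟩ | ⟨ha, hb⟩ | ⟨ha, hb⟩ := hlt _ _ hc <;>
        rcases eq_or_ne a x with hax | hax <;> rcases eq_or_ne b x with hbx | hbx <;>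
        (try subst hax) <;> (try subst hbx) <;> simp_all
    · intro hne hnadj
      refine ⟨[x], y, [x], ?_⟩
      have hcxy := hcxy.resolve_right hnadj
      rcases h3 (c x) with h | h | h <;> simp [hS, h, ← hcxy, hne.symm]
  · obtain ⟨hcxy, hnadj⟩ := not_or.1 hcxy
    obtain ⟨h, h'⟩ | ⟨h, h'⟩ | ⟨h, h'⟩ := hlt _ _ (lt_of_le_of_ne hxy hcxy)
    -- The classes of `x` and `y` are consecutive. In the second round the two letters are
    -- interchanged at the common border, which reverses no other pair of different colours and
    -- gives `xyyx`.
    · refine exists_block_of_sets c x y [S 0, S 1, S 2, S 0 \ {x}, {y}, {x}, S 1 \ {y}, S 2] ?_ ?_ ?_ ?_ ?_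
      · intro a
        rcases h3 (c a) with ha | ha | ha <;> rcases eq_or_ne a x with rfl | hax <;>
          rcases eq_or_ne a y with rfl | hay <;> simp [*]
      · intro s hs
        simp only [List.mem_cons, List.not_mem_nil, or_false] at hs
        rcases hs with rfl | rfl | rfl | rfl | rfl | rfl | rfl | rfl <;>
          simp only [Finset.mem_sdiff, Finset.mem_singleton, hS] <;> grind
      · intro s hs
        simp only [List.mem_cons, List.not_mem_nil, or_false] at hs
        rcases hs with rfl | rfl | rfl | rfl | rfl | rfl | rfl | rfl <;>
          simp only [Finset.mem_sdiff, Finset.mem_singleton, hS] <;> grind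
      · intro a b hab hc
        have hne := hab.ne
        have hne' := hab.ne.symm
        obtain ⟨ha, hb⟩ | ⟨ha, hb⟩ | ⟨ha, hb⟩ := hlt _ _ hc <;>
          rcases eq_or_ne a x with hax | hax <;> rcases eq_or_ne b x with hbx | hbx <;>
          rcases eq_or_ne a y with hay | hay <;> rcases eq_or_ne b y with hby | hby <;>
          (try subst hax) <;> (try subst hbx) <;> (try subst hay) <;> (try subst hby) <;>
          simp_all
      · intro hne hnadj
        refine ⟨[x], y, [x], ?_⟩
        simp [hS, h, h', hne, hne.symm]
    · refine exists_block_of_sets c x y [S 0, S 1, S 2, S 0, S 1 \ {x}, {y}, {x}, S 2 \ {y}] ?_ ?_ ?_ ?_ ?_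
      · intro a
        rcases h3 (c a) with ha | ha | ha <;> rcases eq_or_ne a x with rfl | hax <;>
          rcases eq_or_ne a y with rfl | hay <;> simp [*]
      · intro s hs
        simp only [List.mem_cons, List.not_mem_nil, or_false] at hs
        rcases hs with rfl | rfl | rfl | rfl | rfl | rfl | rfl | rfl <;>
          simp only [Finset.mem_sdiff, Finset.mem_singleton, hS] <;> grind
      · intro s hs
        simp only [List.mem_cons, List.not_mem_nil, or_false] at hs
        rcases hs with rfl | rfl | rfl | rfl | rfl | rfl | rfl | rfl <;>
          simp only [Finset.mem_sdiff, Finset.mem_singleton, hS] <;> grind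
      · intro a b hab hc
        have hne := hab.ne
        have hne' := hab.ne.symm
        obtain ⟨ha, hb⟩ | ⟨ha, hb⟩ | ⟨ha, hb⟩ := hlt _ _ hc <;>
          rcases eq_or_ne a x with hax | hax <;> rcases eq_or_ne b x with hbx | hbx <;>
          rcases eq_or_ne a y with hay | hay <;> rcases eq_or_ne b y with hby | hby <;>
          (try subst hax) <;> (try subst hbx) <;> (try subst hay) <;> (try subst hby) <;>
          simp_all
      · intro hne hnadj
        refine ⟨[x], y, [x], ?_⟩
        simp [hS, h, h', hne, hne.symm]
    -- Class `2` borders on class `0` only where the second round begins: the first `y` is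
    -- interchanged with the second `x`, which gives `xxyy`.
    · refine exists_block_of_sets c x y [S 0, S 1, S 2 \ {y}, {x}, {y}, S 0 \ {x}, S 1, S 2] ?_ ?_ ?_ ?_ ?_
      · intro a
        rcases h3 (c a) with ha | ha | ha <;> rcases eq_or_ne a x with rfl | hax <;>
          rcases eq_or_ne a y with rfl | hay <;> simp [*]
      · intro s hs
        simp only [List.mem_cons, List.not_mem_nil, or_false] at hs
        rcases hs with rfl | rfl | rfl | rfl | rfl | rfl | rfl | rfl <;>
          simp only [Finset.mem_sdiff, Finset.mem_singleton, hS] <;> grind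
      · intro s hs
        simp only [List.mem_cons, List.not_mem_nil, or_false] at hs
        rcases hs with rfl | rfl | rfl | rfl | rfl | rfl | rfl | rfl <;>
          simp only [Finset.mem_sdiff, Finset.mem_singleton, hS] <;> grind
      · intro a b hab hc
        have hne := hab.ne
        have hne' := hab.ne.symm
        obtain ⟨ha, hb⟩ | ⟨ha, hb⟩ | ⟨ha, hb⟩ := hlt _ _ hc <;>
          rcases eq_or_ne a x with hax | hax <;> rcases eq_or_ne b x with hbx | hbx <;>
          rcases eq_or_ne a y with hay | hay <;> rcases eq_or_ne b y with hby | hby <;>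
          (try subst hax) <;> (try subst hbx) <;> (try subst hay) <;> (try subst hby) <;>
          simp_all
      · intro hne hnadj
        refine ⟨[], x, [y, y], ?_⟩
        simp [hS, h, h', hne, hne.symm]

/-- A graph with a proper colouring by three colours is word-representable. -/
theorem SimpleGraph.Coloring.wordRepresentable [Fintype V] {G : SimpleGraph V}
    (c : G.Coloring (Fin 3)) : G.WordRepresentable := by
  classical
  have hB : ∀ q : V × V, ∃ u : List V, (∀ a, a ∈ u) ∧
      (∀ a b, G.Adj a b → c a < c b → u.filter (fun z => z = a ∨ z = b) = [a, b, a, b]) ∧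
      (q.1 ≠ q.2 → ¬ G.Adj q.1 q.2 → ¬ LettersAlternate u q.1 q.2) := by
    rintro ⟨x, y⟩
    rcases le_total (c x) (c y) with h | h
    · exact exists_block c x y h
    · obtain ⟨u, h1, h2, h3⟩ := exists_block c y x h
      exact ⟨u, h1, h2, fun h4 h5 h6 => h3 h4.symm (fun h7 => h5 h7.symm) h6.symm⟩
  choose u hmem hadj hnadj using hB
  let L : List (V × V) := (Finset.univ : Finset (V × V)).toList
  have hL : ∀ q, q ∈ L := fun q => by simp [L]
  have key : ∀ a b, G.Adj a b → c a < c b → LettersAlternate (L.flatMap u) a b := by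
    intro a b hab hc
    unfold LettersAlternate
    rw [List.filter_flatMap, List.flatMap_congr fun q _ => hadj q a b hab hc]
    generalize L = L'
    induction L' with
    | nil => simp
    | cons q L' ih =>
      have hne := hab.ne
      cases L' with
      | nil => simp [hne, hne.symm]
      | cons q' L' => simpa [hne, hne.symm] using ih
  refine ⟨L.flatMap u, fun a => List.mem_flatMap.2 ⟨(a, a), hL _, hmem _ a⟩, fun x y hne => ?_⟩
  constructor
  · intro h
    by_contra hxy
    refine hnadj (x, y) hne hxy (h.infix ?_)
    obtain ⟨s, t, hst⟩ := List.append_of_mem (hL (x, y))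
    rw [hst]
    refine ⟨(s.flatMap u).filter (fun z => z = x ∨ z = y),
      (t.flatMap u).filter (fun z => z = x ∨ z = y), ?_⟩
    simp
  · intro hxy
    rcases lt_or_gt_of_ne (c.valid hxy) with h | h
    · exact key x y hxy h
    · exact (key y x hxy.symm h).symm

end Words

/-!  Closed functions on the darts of a planar rotation system are differences. -/

section Planar

theorem Equiv.Perm.SameCycle.apply_eq {α β : Type*} {f : Equiv.Perm α} {g : α → β}
    (hg : ∀ a, g (f a) = g a) {x y : α} (h : f.SameCycle x y) : g x = g y := by
  obtain ⟨n, rfl⟩ := h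
  have hg' : ∀ a, g (f⁻¹ a) = g a := fun a => by
    rw [← hg]
    simp
  induction n using Int.induction_on with
  | zero => rfl
  | succ n ih => rw [add_comm, zpow_add, zpow_one, Equiv.Perm.mul_apply, hg, ← ih]
  | pred n ih =>
    rw [sub_eq_add_neg, add_comm, zpow_add, zpow_neg_one, Equiv.Perm.mul_apply, hg', ← ih]

theorem finrank_le_card_of_factorsThrough {k α β : Type*} [Field k] [Finite α] [Fintype β]
    (π : α → β) (K : Submodule k (α → k)) (hK : ∀ g ∈ K, g.FactorsThrough π) :
    Module.finrank k K ≤ Fintype.card β := by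
  have hle : K ≤ LinearMap.range (LinearMap.funLeft k k π) := by
    intro g hg
    obtain ⟨e, rfl⟩ := (Function.factorsThrough_iff g).1 (hK g hg)
    exact ⟨e, rfl⟩
  calc Module.finrank k K ≤ Module.finrank k (LinearMap.range (LinearMap.funLeft k k π)) :=
        Submodule.finrank_mono hle
    _ ≤ Module.finrank k (β → k) := LinearMap.finrank_range_le _
    _ = Fintype.card β := Module.finrank_fintype_fun_eq_card k

theorem sum_ncard_fiber {α β : Type*} [Fintype α] [Fintype β] (f : α → β) :
    ∑ b, {a | f a = b}.ncard = Fintype.card α := by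
  classical
  rw [← Finset.card_univ, Finset.card_eq_sum_card_fiberwise (f := f) (t := Finset.univ) (by simp)]
  refine Finset.sum_congr rfl fun b _ => ?_
  rw [← Set.ncard_coe_finset]
  congr 1
  ext
  simp

namespace SimpleGraph

variable {V : Type*} {G : SimpleGraph V}

/-- The chosen darts, one for each edge, serve as the index set of vectors on edges. -/
theorem exists_dart_orientation [Fintype V] :
    ∃ pos : G.Dart → Prop, ∀ d, pos d.symm ↔ ¬ pos d := by
  refine ⟨fun d => Fintype.equivFin V d.fst < Fintype.equivFin V d.snd, fun d => ?_⟩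
  have : Fintype.equivFin V d.fst ≠ Fintype.equivFin V d.snd := by
    simp
  simp only [Prod.fst_swap, Prod.snd_swap, Dart.symm]
  omega

open scoped Classical in
theorem sum_oriented_darts [Fintype G.Dart] {A : Type*} [AddCommMonoid A] {pos : G.Dart → Prop}
    (hpos : ∀ d, pos d.symm ↔ ¬ pos d) (F : G.Dart → A) :
    ∑ d : {d // pos d}, (F d + F d.1.symm) = ∑ d, F d := by
  rw [Finset.sum_add_distrib, ← Finset.sum_filter_add_sum_filter_not Finset.univ pos F,
    Finset.sum_subtype (Finset.univ.filter pos) (p := pos) (by simp)]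
  congr 1
  rw [← Finset.sum_subtype (Finset.univ.filter pos) (p := pos) (by simp) (fun d => F d.symm)]
  refine Finset.sum_nbij' Dart.symm Dart.symm ?_ ?_ ?_ ?_ ?_ <;> simp [hpos]

theorem Reachable.eq_of_isolated {u v : V} (h : G.Reachable u v) (hu : ∀ x, ¬ G.Adj u x) :
    u = v := by
  obtain ⟨p⟩ := h
  cases p with
  | nil => rfl
  | cons h _ => exact absurd h (hu _)

theorem connectedComponentMk_dart (d : G.Dart) :
    G.connectedComponentMk d.snd = G.connectedComponentMk d.fst :=
  ConnectedComponent.eq.2 d.adj.symm.reachable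

end SimpleGraph

namespace RotationSystem

variable {V : Type*} {G : SimpleGraph V} (R : RotationSystem G)

theorem fst_faceStep (d : G.Dart) : (R.faceStep d).fst = d.snd :=
  R.fst_next d.symm

theorem walkThrough_eq_iff {d e : G.Dart} :
    R.walkThrough d = R.walkThrough e ↔ R.faceStep.SameCycle d e :=
  Quotient.eq (r := Equiv.Perm.SameCycle.setoid R.faceStep)

theorem walkThrough_faceStep (d : G.Dart) : R.walkThrough (R.faceStep d) = R.walkThrough d :=
  R.walkThrough_eq_iff.2 (Equiv.Perm.sameCycle_apply_left.2 (Equiv.Perm.SameCycle.refl _ _))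

theorem walkThrough_next (d : G.Dart) : R.walkThrough (R.next d) = R.walkThrough d.symm := by
  rw [← R.walkThrough_faceStep d.symm]
  simp [faceStep]

theorem component_faceStep (d : G.Dart) :
    G.connectedComponentMk (R.faceStep d).fst = G.connectedComponentMk d.fst := by
  rw [R.fst_faceStep, SimpleGraph.connectedComponentMk_dart]

/-- The connected component on which a boundary walk lies. -/
def walkComponent : R.BoundaryWalk → G.ConnectedComponent
  | Sum.inl f => Quotient.lift (s := Equiv.Perm.SameCycle.setoid R.faceStep)
      (fun d => G.connectedComponentMk d.fst) 
      (fun d e (h : R.faceStep.SameCycle d e) => h.apply_eq (g := fun d : G.Dart =>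
        G.connectedComponentMk d.fst) R.component_faceStep) f
  | Sum.inr v => G.connectedComponentMk v.1

theorem walkComponent_walkThrough (d : G.Dart) :
    R.walkComponent (Sum.inl (R.walkThrough d)) = G.connectedComponentMk d.fst := rfl

theorem walkComponent_eq {C : G.ConnectedComponent} {b : R.BoundaryWalk} (hb : b ∈ R.walksOf C) :
    R.walkComponent b = C := by
  obtain ⟨v, hv, rfl⟩ := hb
  rcases b with f | u
  · obtain ⟨d, rfl, rfl⟩ := hv
    rfl
  · obtain rfl : v = u.1 := hv
    rfl

theorem mem_walksOf (d : G.Dart) :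
    (Sum.inl (R.walkThrough d) : R.BoundaryWalk) ∈ R.walksOf (G.connectedComponentMk d.fst) :=
  ⟨d.fst, ⟨d, rfl, rfl⟩, rfl⟩

instance finite_facialWalk [Finite G.Dart] : Finite R.FacialWalk :=
  Quotient.finite _

/-- The dual graph of a component is connected: rotating about a vertex crosses one edge at a time,
and reversing a dart passes to the next vertex of a path. This bounds the kernel of the transposed
matrix in `exists_potential`. -/
theorem eq_of_walkComponent_eq {A : Type*} {g : R.BoundaryWalk → A}
    (hg : ∀ d, g (Sum.inl (R.walkThrough d)) = g (Sum.inl (R.walkThrough d.symm)))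
    {b b' : R.BoundaryWalk} (h : R.walkComponent b = R.walkComponent b') : g b = g b' := by
  have hrot : ∀ d e : G.Dart, d.fst = e.fst →
      g (Sum.inl (R.walkThrough d)) = g (Sum.inl (R.walkThrough e)) := fun d e hde =>
    (R.sameCycle d e hde).apply_eq (g := fun d => g (Sum.inl (R.walkThrough d))) fun d => by
      rw [R.walkThrough_next, ← hg]
  have hreach : ∀ {u v : V}, G.Reachable u v → ∀ d e : G.Dart, d.fst = u → e.fst = v →
      g (Sum.inl (R.walkThrough d)) = g (Sum.inl (R.walkThrough e)) := by
    rintro u v ⟨p⟩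
    induction p with
    | nil => exact fun d e hd he => hrot d e (hd.trans he.symm)
    | @cons u u' v hadj p ih =>
      intro d e hd he
      let a : G.Dart := ⟨(u, u'), hadj⟩
      rw [hrot d a hd, hg a]
      exact ih _ e rfl he
  rcases b with f | u <;> rcases b' with f' | u'
  · obtain ⟨d, rfl⟩ := Quotient.exists_rep f
    obtain ⟨e, rfl⟩ := Quotient.exists_rep f'
    exact hreach (SimpleGraph.ConnectedComponent.eq.1 h) d e rfl rfl
  · obtain ⟨d, rfl⟩ := Quotient.exists_rep f
    have := (SimpleGraph.ConnectedComponent.eq.1 h).symm.eq_of_isolated u'.2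
    exact absurd (this ▸ d.adj) (u'.2 _)
  · obtain ⟨d, rfl⟩ := Quotient.exists_rep f'
    have := (SimpleGraph.ConnectedComponent.eq.1 h).eq_of_isolated u.2
    exact absurd (this ▸ d.adj) (u.2 _)
  · have := (SimpleGraph.ConnectedComponent.eq.1 h).eq_of_isolated u.2
    rw [Subtype.ext this]

theorem ncard_oriented_darts_le [Finite V] {pos : G.Dart → Prop}
    (hpos : ∀ d, pos d.symm ↔ ¬ pos d) (C : G.ConnectedComponent) :
    {d : {d // pos d} | G.connectedComponentMk d.1.fst = C}.ncard ≤
      C.toSimpleGraph.edgeSet.ncard := by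
  have hinj : Set.InjOn (fun d : {d // pos d} => d.1.edge)
      {d | G.connectedComponentMk d.1.fst = C} := by
    rintro ⟨d, hd⟩ - ⟨e, he⟩ - h
    rcases (SimpleGraph.dart_edge_eq_iff d e).1 h with rfl | rfl
    · rfl
    · exact absurd he ((hpos e).1 hd)
  rw [← hinj.ncard_image]
  refine le_trans (Set.ncard_le_ncard ?_ (Set.toFinite _))
    (Set.ncard_image_le (f := Sym2.map (Subtype.val : C → V)) (Set.toFinite _))
  rintro _ ⟨⟨d, hd⟩, rfl, rfl⟩
  refine ⟨s(⟨d.fst, rfl⟩, ⟨d.snd, SimpleGraph.connectedComponentMk_dart d⟩), ?_, rfl⟩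
  exact d.adj

-- Euler's formula summed over the components. The inequality is enough for the dimension count,
-- since the opposite bound expresses that differences are closed.
open scoped Classical in
theorem IsPlanar.two_mul_card_le [Fintype V] {R : RotationSystem G} (hR : R.IsPlanar)
    [Fintype R.BoundaryWalk] {pos : G.Dart → Prop} (hpos : ∀ d, pos d.symm ↔ ¬ pos d) :
    2 * Fintype.card G.ConnectedComponent + Fintype.card {d // pos d} ≤
      Fintype.card V + Fintype.card R.BoundaryWalk := by
  have hV := sum_ncard_fiber G.connectedComponentMk
  have hE := sum_ncard_fiber fun d : {d // pos d} => G.connectedComponentMk d.1.fst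
  have hW := sum_ncard_fiber R.walkComponent
  rw [← hV, ← hE, ← hW, ← Finset.sum_add_distrib, ← Finset.card_univ, mul_comm, ← smul_eq_mul,
    ← Finset.sum_const, ← Finset.sum_add_distrib]
  refine Finset.sum_le_sum fun C _ => ?_
  have h1 := hR C
  have h2 := ncard_oriented_darts_le hpos C
  have h3 : (R.walksOf C).ncard ≤ {b | R.walkComponent b = C}.ncard :=
    Set.ncard_le_ncard (fun b hb => R.walkComponent_eq hb) (Set.toFinite _)
  have h4 : C.supp = {v | G.connectedComponentMk v = C} := rfl
  rw [h4] at h1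
  omega

open scoped Classical in
/-- On the sphere the first cohomology vanishes: an antisymmetric function on the darts that sums
to zero along every facial walk is the difference of a function on the vertices. -/
theorem IsPlanar.exists_potential [Fintype V] {R : RotationSystem G} (hR : R.IsPlanar)
    {k : Type*} [Field k] (φ : G.Dart → k) (hanti : ∀ d, φ d.symm = -φ d)
    (hface : ∀ f, ∑ d with R.walkThrough d = f, φ d = 0) :
    ∃ c : V → k, ∀ d, φ d = c d.snd - c d.fst := by
  obtain ⟨pos, hpos⟩ := G.exists_dart_orientation
  let : Fintype R.BoundaryWalk := Fintype.ofFinite _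
  -- Row `b` is the signed boundary of the walk `b`; an edge traversed in both directions by one
  -- walk cancels. The kernel of `M` consists of the closed functions, the range of `N` of the
  -- differences.
  let M : Matrix R.BoundaryWalk {d // pos d} k := fun b d =>
    (if b = Sum.inl (R.walkThrough d) then 1 else 0) -
      (if b = Sum.inl (R.walkThrough d.1.symm) then 1 else 0)
  let N : (V → k) →ₗ[k] ({d // pos d} → k) :=
    { toFun := fun c d => c d.1.snd - c d.1.fst
      map_add' := fun c c' => by ext d; simp; ring
      map_smul' := fun a c => by ext d; simp; ring }
  have hMvec : ∀ ψ : G.Dart → k, (∀ d, ψ d.symm = -ψ d) →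
      (∀ f, ∑ d with R.walkThrough d = f, ψ d = 0) → M.mulVec (fun d => ψ d) = 0 := by
    intro ψ hψ hψf
    funext b
    have h1 : M.mulVec (fun d => ψ d) b =
        ∑ d, if b = Sum.inl (R.walkThrough d) then ψ d else 0 := by
      rw [← SimpleGraph.sum_oriented_darts hpos]
      refine Finset.sum_congr rfl fun d _ => ?_
      simp only [M, hψ]
      split_ifs <;> ring
    rw [h1]
    rcases b with f | v
    · rw [← Finset.sum_filter]
      simpa [eq_comm] using hψf f
    · simp
  have hNM : LinearMap.range N ≤ LinearMap.ker M.mulVecLin := by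
    rintro _ ⟨c, rfl⟩
    refine hMvec (fun d => c d.snd - c d.fst) (fun d => by simp) fun f => ?_
    rw [Finset.sum_sub_distrib, sub_eq_zero]
    refine Finset.sum_nbij' R.faceStep R.faceStep.symm ?_ ?_ ?_ ?_ ?_
    · intro d hd
      simpa [R.walkThrough_faceStep] using hd
    · intro d hd
      have := R.walkThrough_faceStep (R.faceStep.symm d)
      rw [Equiv.apply_symm_apply] at this
      simpa [← this] using hd
    · simp
    · simp
    · intro d _
      rw [R.fst_faceStep]
  have hkerN : Module.finrank k (LinearMap.ker N) ≤ Fintype.card G.ConnectedComponent := by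
    refine finrank_le_card_of_factorsThrough G.connectedComponentMk _ fun c hc u v huv => ?_
    have hadj : ∀ u v, G.Adj u v → c u = c v := by
      intro u v h
      have hc' : ∀ d : {d // pos d}, c d.1.snd - c d.1.fst = 0 := fun d => congrFun hc d
      let d : G.Dart := ⟨(u, v), h⟩
      by_cases hd : pos d
      · exact (sub_eq_zero.1 (hc' ⟨d, hd⟩)).symm
      · exact sub_eq_zero.1 (hc' ⟨d.symm, (hpos d).2 hd⟩)
    obtain ⟨p⟩ := SimpleGraph.ConnectedComponent.eq.1 huv
    clear huv
    induction p with
    | nil => rfl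
    | cons h _ ih => exact (hadj _ _ h).trans ih
  have hkerMT : Module.finrank k (LinearMap.ker M.transpose.mulVecLin) ≤
      Fintype.card G.ConnectedComponent := by
    refine finrank_le_card_of_factorsThrough R.walkComponent _ fun g hg b b' hb => ?_
    refine R.eq_of_walkComponent_eq (fun d => ?_) hb
    have hval : ∀ d : {d // pos d},
        g (Sum.inl (R.walkThrough d)) - g (Sum.inl (R.walkThrough d.1.symm)) = 0 := by
      intro d
      have : ∑ b, M b d * g b = 0 := congrFun hg d
      simpa [M, sub_mul, Finset.sum_sub_distrib] using this
    by_cases hd : pos d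
    · exact sub_eq_zero.1 (hval ⟨d, hd⟩)
    · have := (sub_eq_zero.1 (hval ⟨d.symm, (hpos d).2 hd⟩)).symm
      simpa using this
  have hrank : M.rank = M.transpose.rank := M.rank_transpose.symm
  have h1 := M.mulVecLin.finrank_range_add_finrank_ker
  have h2 := M.transpose.mulVecLin.finrank_range_add_finrank_ker
  have h3 := N.finrank_range_add_finrank_ker
  rw [Module.finrank_fintype_fun_eq_card] at h1 h2 h3
  have h4 := hR.two_mul_card_le hpos
  -- Write `V`, `E`, `W`, `C` for the numbers of vertices, edges, boundary walks and components.
  -- Then `dim ker M = E - rank M ≤ E - W + C`, and `dim range N ≥ V - C`. Euler's inequality `2C +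
  -- E ≤ V + W` makes the first bound at most the second.
  have heq : LinearMap.range N = LinearMap.ker M.mulVecLin := by
    refine Submodule.eq_of_le_of_finrank_le hNM ?_
    unfold Matrix.rank at hrank
    omega
  have hφ : (fun d : {d // pos d} => φ d) ∈ LinearMap.ker M.mulVecLin := hMvec φ hanti hface
  rw [← heq] at hφ
  obtain ⟨c, hc⟩ := hφ
  refine ⟨c, fun d => ?_⟩
  by_cases hd : pos d
  · exact (congrFun hc ⟨d, hd⟩).symm
  · have := congrFun hc ⟨d.symm, (hpos d).2 hd⟩
    simp only [hanti] at this
    have h5 : c d.fst - c d.snd = -φ d := this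
    rw [← neg_sub, h5, neg_neg]

end RotationSystem

end Planar

/-! ### Outer darts, triangular faces, and the parity of inner degrees. -/

namespace PlaneEmbedding

variable {V : Type*} {G : SimpleGraph V} (P : PlaneEmbedding G)

/-- The left side of the dart `d` is the outer face. -/
def IsOuterDart (d : G.Dart) : Prop :=
  P.face (Sum.inl (P.toRotationSystem.walkThrough d)) = P.outer

theorem isOuterDart_congr {d e : G.Dart}
    (h : P.toRotationSystem.walkThrough d = P.toRotationSystem.walkThrough e) :
    P.IsOuterDart d ↔ P.IsOuterDart e := by
  simp only [IsOuterDart, h]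

/-- A component has at most one facial walk on the outer face, because its boundary walks bound
different faces. -/
theorem walkThrough_eq_of_isOuterDart {d e : G.Dart} (hd : P.IsOuterDart d) (he : P.IsOuterDart e)
    (h : G.connectedComponentMk d.fst = G.connectedComponentMk e.fst) :
    P.toRotationSystem.walkThrough d = P.toRotationSystem.walkThrough e := by
  have h1 := P.toRotationSystem.mem_walksOf d
  rw [h] at h1
  exact Sum.inl_injective
    (P.face_injOn _ h1 (P.toRotationSystem.mem_walksOf e) (hd.trans he.symm))

theorem incident_outer_iff {v : V} : P.Incident v P.outer ↔
    (∃ d : G.Dart, P.IsOuterDart d ∧ d.fst = v) ∨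
      ∃ h : ∀ u, ¬ G.Adj v u, P.face (Sum.inr ⟨v, h⟩) = P.outer := by
  constructor
  · rintro ⟨f | u, hb, hv⟩
    · obtain ⟨d, rfl, rfl⟩ := hv
      exact Or.inl ⟨d, hb, rfl⟩
    · obtain rfl : v = u.1 := hv
      exact Or.inr ⟨u.2, hb⟩
  · rintro (⟨d, hd, rfl⟩ | ⟨h, hv⟩)
    · exact ⟨_, hd, d, rfl, rfl⟩
    · exact ⟨_, hv, rfl⟩

variable {P}

theorem IsNearTriangulation.ncard_eq_three (hP : P.IsNearTriangulation) {d : G.Dart}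
    (hd : ¬ P.IsOuterDart d) :
    {e | P.toRotationSystem.walkThrough e = P.toRotationSystem.walkThrough d}.ncard = 3 := by
  obtain ⟨b, hb, h3⟩ := hP _ hd
  rw [← (hb (Sum.inl (P.toRotationSystem.walkThrough d))).1 rfl] at h3
  exact h3

theorem IsNearTriangulation.faceStep_three (hP : P.IsNearTriangulation) {d : G.Dart}
    (hd : ¬ P.IsOuterDart d) :
    P.toRotationSystem.faceStep (P.toRotationSystem.faceStep
      (P.toRotationSystem.faceStep d)) = d := by
  set R := P.toRotationSystem
  have h3 : {e | R.walkThrough e = R.walkThrough d}.ncard = 3 := hP.ncard_eq_three hd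
  have hne : ∀ e, R.faceStep e ≠ e := fun e h => by
    have := R.fst_faceStep e
    rw [h] at this
    exact e.adj.ne this
  have hne2 : R.faceStep (R.faceStep d) ≠ d := by
    intro h
    have hsub : {e | R.walkThrough e = R.walkThrough d} ⊆ {d, R.faceStep d} := by
      intro e he
      have := (R.walkThrough_eq_iff.1 he).apply_eq (g := fun e => e = d ∨ e = R.faceStep d) (by
        intro a
        refine propext ⟨?_, ?_⟩
        · rintro (ha | ha)
          · exact Or.inr (R.faceStep.injective (ha.trans h.symm))
          · exact Or.inl (R.faceStep.injective ha)
        · rintro (rfl | rfl)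
          · exact Or.inr rfl
          · exact Or.inl h)
      exact this.mpr (Or.inl rfl)
    have := Set.ncard_le_ncard hsub (Set.toFinite _)
    rw [Set.ncard_pair (hne d).symm] at this
    omega
  have hsub : {d, R.faceStep d, R.faceStep (R.faceStep d)} ⊆
      {e | R.walkThrough e = R.walkThrough d} := by
    rintro e (rfl | rfl | rfl) <;> simp [R.walkThrough_faceStep]
  have hcard : ({d, R.faceStep d, R.faceStep (R.faceStep d)} : Set G.Dart).ncard = 3 :=
    Set.ncard_eq_three.2 ⟨_, _, _, (hne d).symm, hne2.symm, (hne _).symm, rfl⟩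
  have heq := Set.eq_of_subset_of_ncard_le hsub (by rw [h3, hcard])
    (Set.finite_of_ncard_ne_zero (by rw [h3]; norm_num))
  have hmem : R.faceStep (R.faceStep (R.faceStep d)) ∈
      {e | R.walkThrough e = R.walkThrough d} := by
    simp [R.walkThrough_faceStep]
  rw [← heq] at hmem
  rcases hmem with h | h | h
  · exact h
  · exact absurd (R.faceStep.injective h) hne2
  · exact absurd h (hne _)

/-- The darts `d.symm` and `P.next d` are consecutive on their facial walk, and the third dart of
the triangle joins their far ends. -/
theorem IsNearTriangulation.adj_next (hP : P.IsNearTriangulation) {d : G.Dart}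
    (hd : ¬ P.IsOuterDart d.symm) : G.Adj (P.next d).snd d.snd := by
  set R := P.toRotationSystem
  have h := hP.faceStep_three hd
  have h1 : R.faceStep d.symm = R.next d := by simp [RotationSystem.faceStep]
  have h2 := R.fst_faceStep (R.faceStep (R.faceStep d.symm))
  have h3 := R.fst_faceStep (R.faceStep d.symm)
  have h4 := (R.faceStep (R.faceStep d.symm)).adj
  rw [h] at h2
  rw [h3, ← h2, h1] at h4
  exact h4

/-- A word-representable near-triangulation without `K₄` is internally even. -/
theorem IsNearTriangulation.internallyEven [DecidableEq V] [Fintype V] [DecidableRel G.Adj]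
    (hP : P.IsNearTriangulation) (hK4 : G.CliqueFree 4) (hG : G.WordRepresentable) :
    P.InternallyEven := by
  classical
  intro v hv
  obtain ⟨q, hq⟩ := hG.exists_neighbor_bicoloring hK4 v
  have hnext : ∀ d : G.Dart, d.fst = v → (q (P.next d).snd ↔ ¬ q d.snd) := by
    intro d hd
    have h1 : (P.next d).fst = v := (P.fst_next d).trans hd
    refine hq _ _ (h1 ▸ (P.next d).adj) (hd ▸ d.adj) (hP.adj_next fun h => ?_)
    rw [P.isOuterDart_congr (P.toRotationSystem.walkThrough_next d).symm] at h
    exact hv (P.incident_outer_iff.2 (Or.inl ⟨_, h, h1⟩))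
  have hcard : (Finset.univ.filter fun d : G.Dart => d.fst = v).card = G.degree v := by
    rw [← G.dart_fst_fiber_card_eq_degree v]
  -- The rotation at `v` exchanges the two colour classes of darts, so they have equal size.
  have h1 : {d : G.Dart | d.fst = v ∧ q d.snd}.ncard ≤
      {d : G.Dart | d.fst = v ∧ ¬ q d.snd}.ncard := by
    refine Set.ncard_le_ncard_of_injOn P.next ?_ P.next.injective.injOn (Set.toFinite _)
    rintro d ⟨hd, hqd⟩
    exact ⟨(P.fst_next d).trans hd, fun h => (hnext d hd).1 h hqd⟩
  have h2 : {d : G.Dart | d.fst = v ∧ ¬ q d.snd}.ncard ≤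
      {d : G.Dart | d.fst = v ∧ q d.snd}.ncard := by
    refine Set.ncard_le_ncard_of_injOn P.next ?_ P.next.injective.injOn (Set.toFinite _)
    rintro d ⟨hd, hqd⟩
    exact ⟨(P.fst_next d).trans hd, (hnext d hd).2 hqd⟩
  rw [← hcard, ← Finset.card_filter_add_card_filter_not (fun d : G.Dart => q d.snd),
    Finset.filter_filter, Finset.filter_filter, ← Set.ncard_coe_finset, ← Set.ncard_coe_finset]
  simp only [Finset.coe_filter, Finset.mem_univ, true_and]
  rw [le_antisymm h1 h2]
  exact ⟨_, rfl⟩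

/-! ### From even inner degrees to a 3-colouring. -/

theorem potential_eq_of_isOuterDart {A : Type*} {c : V → A}
    (hc : ∀ d, P.IsOuterDart d → c d.snd = c d.fst) {d e : G.Dart} (hd : P.IsOuterDart d)
    (he : P.IsOuterDart e) (h : G.connectedComponentMk d.fst = G.connectedComponentMk e.fst) :
    c d.fst = c e.fst := by
  classical
  have hcyc := P.toRotationSystem.walkThrough_eq_iff.1 (P.walkThrough_eq_of_isOuterDart hd he h)
  -- The function has to be invariant under `faceStep` at every dart, hence the constant value
  -- `none` off the outer walks.
  have := hcyc.apply_eq (g := fun d => if P.IsOuterDart d then some (c d.fst) else none) (by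
    intro a
    have h1 := P.isOuterDart_congr (P.toRotationSystem.walkThrough_faceStep a)
    simp only [h1, P.toRotationSystem.fst_faceStep]
    split_ifs with ha
    · rw [hc a ha]
    · rfl)
  simpa [hd, he] using this

open scoped Classical in
/-- If all inner vertices have even degree, then the facial walks have a colouring by two colours
under which facial walks that share an edge not on the outer face get different colours. -/
theorem exists_face_bicoloring [Fintype V]
    (heven : ∀ v : V, ¬ P.Incident v P.outer → Even {d : G.Dart | d.fst = v}.ncard) :
    ∃ s : P.toRotationSystem.FacialWalk → ZMod 2, ∀ d : G.Dart,
      ¬ P.IsOuterDart d → ¬ P.IsOuterDart d.symm →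
        s (P.toRotationSystem.walkThrough d) + s (P.toRotationSystem.walkThrough d.symm) = 1 := by
  set R := P.toRotationSystem 
  obtain ⟨pos, hpos⟩ := G.exists_dart_orientation
  let inner : G.Dart → Prop := fun d => ¬ P.IsOuterDart d ∧ ¬ P.IsOuterDart d.symm
  have hinner : ∀ d, inner d.symm ↔ inner d := fun d => by simp [inner, and_comm]
  let A : (R.FacialWalk → ZMod 2) →ₗ[ZMod 2] ({d // pos d} → ZMod 2) :=
    { toFun := fun s d =>
        if inner d then s (R.walkThrough d) + s (R.walkThrough d.1.symm) else 0
      map_add' := fun s t => by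
        ext d
        simp only [Pi.add_apply]
        split_ifs
        · ring
        · simp
      map_smul' := fun a s => by
        ext d
        simp only [Pi.smul_apply, smul_eq_mul, RingHom.id_apply]
        split_ifs
        · ring
        · simp }
  let b : {d // pos d} → ZMod 2 := fun d => if inner d then 1 else 0
  suffices hb : b ∈ LinearMap.range A by
    obtain ⟨s, hs⟩ := hb
    have hs' : ∀ d : {d // pos d}, inner d →
        s (R.walkThrough d) + s (R.walkThrough d.1.symm) = 1 := by
      intro d hd
      simpa [A, b, hd] using congrFun hs d
    refine ⟨s, fun d h1 h2 => ?_⟩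
    by_cases hd : pos d
    · exact hs' ⟨d, hd⟩ ⟨h1, h2⟩
    · have := hs' ⟨d.symm, (hpos d).2 hd⟩ ((hinner d).2 ⟨h1, h2⟩)
      rw [add_comm]
      simpa using this
  -- Duality: if `b` were not in the range, some functional vanishing on the range would be nonzero
  -- at `b`. Every such functional is shown to vanish at `b`.
  by_contra hb
  obtain ⟨l, hlb, hl⟩ := Submodule.exists_le_ker_of_notMem hb
  refine hlb ?_
  let m : {d // pos d} → ZMod 2 := fun d => l (Pi.single d 1)
  have hlm : ∀ h, l h = ∑ d, h d * m d := fun h => by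
    rw [LinearMap.pi_apply_eq_sum_univ l h]
    refine Finset.sum_congr rfl fun d _ => ?_
    simp only [smul_eq_mul, m]
    congr 3
    ext e
    simp [Pi.single_apply, eq_comm]
  -- The functional as weights on the inner edges, antisymmetric since signs do not matter modulo
  -- `2`. That it kills the range of `A` says that the weights sum to zero along each facial walk.
  let y : G.Dart → ZMod 2 := fun d =>
    if inner d then if h : pos d then m ⟨d, h⟩ else m ⟨d.symm, (hpos d).2 h⟩ else 0
  have hysymm : ∀ d, y d.symm = y d := by
    intro d
    by_cases hi : inner d
    · by_cases hd : pos d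
      · simp [y, hinner, hi, hd, hpos]
      · simp [y, hinner, hi, hd, hpos]
    · simp [y, hinner, hi]
  have hypos : ∀ d : {d // pos d}, y d = if inner d then m d else 0 := fun d => by
    simp [y, d.2]
  obtain ⟨c, hc⟩ := P.isPlanar.exists_potential y (fun d => by rw [hysymm, CharTwo.neg_eq])
    (by
      intro f
      have h0 : l (A (Pi.single f 1)) = 0 := hl ⟨_, rfl⟩
      rw [hlm] at h0
      rw [Finset.sum_filter, ← SimpleGraph.sum_oriented_darts hpos]
      refine Eq.trans ?_ h0
      refine Finset.sum_congr rfl fun d _ => ?_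
      rw [hysymm, hypos]
      by_cases hi : inner d
      · simp [A, R, hi, add_mul, Pi.single_apply]
      · simp [A, hi])
  have houter : ∀ d, P.IsOuterDart d → c d.snd = c d.fst := by
    intro d hd
    have : y d = 0 := if_neg fun h => h.1 hd
    rw [hc] at this
    exact sub_eq_zero.1 this
  -- The potential is constant on the outer walk of each component; subtracting that constant makes
  -- it zero there. In a component without outer darts any constant would do, since all darts there
  -- leave inner vertices.
  let κ : G.ConnectedComponent → ZMod 2 := fun C =>
    if h : ∃ d : G.Dart, P.IsOuterDart d ∧ G.connectedComponentMk d.fst = C then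
      c h.choose.fst else 0
  let c' : V → ZMod 2 := fun v => c v - κ (G.connectedComponentMk v)
  have hc'0 : ∀ d, P.IsOuterDart d → c' d.fst = 0 := by
    intro d hd
    have h : ∃ e : G.Dart, P.IsOuterDart e ∧
      G.connectedComponentMk e.fst = G.connectedComponentMk d.fst := ⟨d, hd, rfl⟩
    have := potential_eq_of_isOuterDart houter h.choose_spec.1 hd h.choose_spec.2
    simp only [c', κ, dif_pos h, this, sub_self]
  have hyc' : ∀ d, y d = c' d.fst + c' d.symm.fst := by
    intro d
    have : c' d.symm.fst = c d.snd - κ (G.connectedComponentMk d.fst) := by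
      rw [← SimpleGraph.connectedComponentMk_dart d]
      rfl
    rw [this, hc, CharTwo.sub_eq_add, CharTwo.sub_eq_add]
    simp only [c', CharTwo.sub_eq_add]
    rw [add_add_add_comm, CharTwo.add_self_eq_zero, add_zero, add_comm]
  -- A handshake count: the sum over edges becomes the sum of `deg v * c' v`, in which outer
  -- vertices contribute nothing by normalisation and inner ones nothing by parity.
  calc l b = ∑ d : {d // pos d}, (c' d.1.fst + c' d.1.symm.fst) := by
        rw [hlm]
        refine Finset.sum_congr rfl fun d _ => ?_
        rw [← hyc', hypos]
        simp [b]
    _ = ∑ d : G.Dart, c' d.fst := SimpleGraph.sum_oriented_darts hpos fun d => c' d.fst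
    _ = ∑ v, ∑ d : G.Dart with d.fst = v, c' d.fst := (Finset.sum_fiberwise _ _ _).symm
    _ = 0 := by
        refine Finset.sum_eq_zero fun v _ => ?_
        by_cases hv : P.Incident v P.outer
        · refine Finset.sum_eq_zero fun d hd => ?_
          obtain rfl : d.fst = v := by simpa using hd
          rcases P.incident_outer_iff.1 hv with ⟨e, he, hev⟩ | ⟨h, -⟩
          · rw [← hev]
            exact hc'0 e he
          · exact absurd d.adj (h _)
        · rw [Finset.sum_congr rfl (g := fun _ => c' v) (by simp +contextual), Finset.sum_const]
          obtain ⟨n, hn⟩ := heven v hv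
          have : (Finset.univ.filter fun d : G.Dart => d.fst = v).card = n + n := by
            rw [← hn, ← Set.ncard_coe_finset]
            simp
          rw [this, add_smul, CharTwo.add_self_eq_zero]

open scoped Classical in
/-- A near-triangulation that is internally even is 3-colourable. -/
theorem IsNearTriangulation.exists_coloring [Fintype V] (hP : P.IsNearTriangulation)
    (heven : ∀ v : V, ¬ P.Incident v P.outer → Even {d : G.Dart | d.fst = v}.ncard) :
    Nonempty (G.Coloring (Fin 3)) := by
  set R := P.toRotationSystem
  obtain ⟨s, hs⟩ := exists_face_bicoloring heven
  obtain ⟨pos, hpos⟩ := G.exists_dart_orientation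
  let : Fintype R.FacialWalk := Fintype.ofFinite _
  let σ : ZMod 2 → ZMod 3 := fun a => if a = 0 then 1 else -1
  have hσ : ∀ a b, a + b = 1 → σ b = -σ a := by decide
  have hσ0 : ∀ a, σ a ≠ 0 := by decide
  -- The value comes from the face on the left if that is bounded, otherwise by antisymmetry from
  -- the right; edges with the outer face on both sides get an arbitrary sign.
  let φ : G.Dart → ZMod 3 := fun d =>
    if ¬ P.IsOuterDart d then σ (s (R.walkThrough d))
    else if ¬ P.IsOuterDart d.symm then -σ (s (R.walkThrough d.symm))
    else if pos d then 1 else -1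
  have hφ0 : ∀ d, φ d ≠ 0 := by
    intro d
    simp only [φ]
    split_ifs <;> first | decide | exact neg_ne_zero.2 (hσ0 _) | exact hσ0 _
  have hanti : ∀ d, φ d.symm = -φ d := by
    intro d
    by_cases h1 : P.IsOuterDart d <;> by_cases h2 : P.IsOuterDart d.symm
    · by_cases hd : pos d <;> simp [φ, h1, h2, hpos, hd]
    · simp [φ, h1, h2]
    · simp [φ, h1, h2]
    · simpa [φ, h1, h2] using hσ _ _ (hs d h1 h2)
  have htri : ∀ d, ¬ P.IsOuterDart d → ∑ e with R.walkThrough e = R.walkThrough d, φ e = 0 := by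
    intro d hd
    have h3 := hP.ncard_eq_three hd
    rw [Finset.sum_congr rfl (g := fun _ => σ (s (R.walkThrough d))), Finset.sum_const,
      ← Set.ncard_coe_finset]
    · simp only [Finset.coe_filter, Finset.mem_univ, true_and]
      rw [h3]
      generalize σ (s (R.walkThrough d)) = z
      revert z
      decide
    · intro e he
      have he' : R.walkThrough e = R.walkThrough d := by simpa using he
      simp only [φ]
      rw [if_pos ((P.isOuterDart_congr he').not.2 hd), he']
  have hface : ∀ f, ∑ d with R.walkThrough d = f, φ d = 0 := by
    intro f
    obtain ⟨d, rfl⟩ : ∃ d, R.walkThrough d = f := Quotient.exists_rep f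
    by_cases hd : P.IsOuterDart d
    swap
    · exact htri d hd
    -- The outer walk need not be a triangle. By antisymmetry `φ` sums to zero over all darts of the
    -- component, and all its other facial walks are triangles with sum zero, so the outer walk has
    -- sum zero too.
    have hzero : ∑ e : G.Dart,
        (if G.connectedComponentMk e.fst = G.connectedComponentMk d.fst then φ e else 0) = 0 := by
      rw [← SimpleGraph.sum_oriented_darts hpos]
      refine Finset.sum_eq_zero fun e _ => ?_
      have : G.connectedComponentMk e.1.symm.fst = G.connectedComponentMk e.1.fst :=
        SimpleGraph.connectedComponentMk_dart e.1
      rw [this, hanti]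
      split_ifs <;> simp
    have hcomp : ∀ e e' : G.Dart, R.walkThrough e = R.walkThrough e' →
        G.connectedComponentMk e.fst = G.connectedComponentMk e'.fst := by
      intro e e' h
      rw [← R.walkComponent_walkThrough, h, R.walkComponent_walkThrough]
    rw [← Finset.sum_fiberwise Finset.univ R.walkThrough,
      Finset.sum_eq_single (R.walkThrough d)] at hzero
    · rw [← hzero]
      refine Finset.sum_congr rfl fun e he => ?_
      rw [if_pos (hcomp e d (by simpa using he))]
    · intro f _ hf
      obtain ⟨d', rfl⟩ : ∃ d, R.walkThrough d = f := Quotient.exists_rep f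
      by_cases hC : G.connectedComponentMk d'.fst = G.connectedComponentMk d.fst
      · rw [← htri d' fun hd' => hf (P.walkThrough_eq_of_isOuterDart hd' hd hC)]
        refine Finset.sum_congr rfl fun e he => ?_
        rw [if_pos ((hcomp e d' (by simpa using he)).trans hC)]
      · refine Finset.sum_eq_zero fun e he => if_neg fun h => hC ?_
        rw [← h, hcomp e d' (by simpa using he)]
    · simp
  obtain ⟨c, hc⟩ := P.isPlanar.exists_potential φ hanti hface
  -- `ZMod 3` unfolds to `Fin 3`, so the potential itself is the colouring; it is proper because `φ`
  -- is nowhere zero.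
  refine ⟨SimpleGraph.Coloring.mk (α := Fin 3) c fun {u v} huv h => ?_⟩
  refine hφ0 ⟨(u, v), huv⟩ ?_
  rw [hc]
  exact sub_eq_zero.2 h.symm

end PlaneEmbedding

theorem theorem2p4 {V : Type*} [Fintype V] [DecidableEq V] (G : SimpleGraph V)
    [DecidableRel G.Adj] (P : PlaneEmbedding G) (hP : P.IsNearTriangulation)
    (hK4 : G.CliqueFree 4) :
    G.WordRepresentable ↔ P.InternallyEven := by
  refine ⟨hP.internallyEven hK4, fun h => ?_⟩
  obtain ⟨c⟩ := hP.exists_coloring fun v hv => by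
    rw [Set.ncard_eq_toFinset_card', Set.toFinset_ofPred, G.dart_fst_fiber_card_eq_degree v]
    exact h v hv
  exact c.wordRepresentable
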